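/- Let $x_1,\dots,x_n\in\mathbb{R}^d$, let $0\le p<d$, let $\mu=\frac1n\sum_{i=1}^n x_i$ be the data mean and $S=\frac1n\sum_{i=1}^n(x_i-\mu)(x_i-\mu)^\top$ the sample covariance, with eigenvalues $\delta_1\ge\dots\ge\delta_d$ (counted with multiplicity). Assume $\delta_{p+1}>0$, i.e. $\operatorname{rank} S>p$. In probabilistic PCA (factor analysis with noise covariance $\Psi=\sigma^2 I$) each data point has the marginal law $\mathcal{N}(\mu,\Lambda\Lambda^\top+\sigma^2I)$, and the log-likelihood of $\Lambda\in\mathbb{R}^{d\times p}$ and $\sigma>0$ is $$\ell(\Lambda,\sigma)=\sum_{i=1}^n\log\left[\frac{1}{\sqrt{(2\pi)^d\det C}}\exp\left(-\tfrac12(x_i-\mu)^\top C^{-1}(x_i-\mu)\right)\right],\qquad C=\Lambda\Lambda^\top+\sigma^2I.$$ Then $\ell$ attains its maximum over $\mathbb{R}^{d\times p}\times(0,\infty)$, and a pair $(\Lambda,\sigma)$ with $\sigma>0$ is a global maximizer if and only if $$\sigma^2=\frac{1}{d-p}\sum_{j=p+1}^d\delta_j\qquad\text{and}\qquad \Lambda=U(\Delta_p-\sigma^2I)^{1/2}R$$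 for some $U\in\mathbb{R}^{d\times p}$ with $U^\top U=I$ and $SU=U\Delta_p$ (its columns are orthonormal eigenvectors of $S$ for the top $p$ eigenvalues) and some orthogonal matrix $R\in\mathbb{R}^{p\times p}$, where $\Delta_p=\operatorname{diag}(\delta_1,\dots,\delta_p)$ and $(\Delta_p-\sigma^2I)^{1/2}=\operatorname{diag}\big(\sqrt{\delta_1-\sigma^2},\dots,\sqrt{\delta_p-\sigma^2}\big)$. In particular every such choice of $U$ and $R$ (for instance $R=I$) gives a maximizer. -/

import Mathlib

open scoped Matrix

namespace PPCA

/-- The density at `y` of the multivariate normal distribution `N(μ, C)` on `ℝ^d`. -/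
noncomputable def gaussianDensity {d : ℕ} (μ : Fin d → ℝ) (C : Matrix (Fin d) (Fin d) ℝ)
    (y : Fin d → ℝ) : ℝ :=
  1 / Real.sqrt ((2 * Real.pi) ^ d * C.det) *
    Real.exp (-((y - μ) ⬝ᵥ (C⁻¹ *ᵥ (y - μ))) / 2)

/-- The mean `μ = (1/n) ∑ i, x i` of the data. -/
noncomputable def sampleMean {d n : ℕ} (x : Fin n → Fin d → ℝ) : Fin d → ℝ :=
  (1 / (n : ℝ)) • ∑ i, x i

/-- The sample covariance `S = (1/n) ∑ i, (x i - μ) (x i - μ)ᵀ` of the data. -/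
noncomputable def sampleCovariance {d n : ℕ} (x : Fin n → Fin d → ℝ) :
    Matrix (Fin d) (Fin d) ℝ :=
  (1 / (n : ℝ)) • ∑ i, Matrix.vecMulVec (x i - sampleMean x) (x i - sampleMean x)

theorem sampleCovariance_isHermitian {d n : ℕ} (x : Fin n → Fin d → ℝ) :
    (sampleCovariance x).IsHermitian := by
  ext a b
  simp [sampleCovariance, Matrix.sum_apply, Matrix.vecMulVec_apply, mul_comm]

/-- The eigenvalues of the sample covariance, with multiplicity, in decreasing order:
`sampleEigenvalue x j` is `δ_{j+1}`, as `j` counts from `0`. -/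
noncomputable def sampleEigenvalue {d n : ℕ} (x : Fin n → Fin d → ℝ) (j : Fin d) : ℝ :=
  (sampleCovariance_isHermitian x).eigenvalues₀ (Fin.cast (Fintype.card_fin d).symm j)

/-- The top `p` eigenvalues `δ_1, …, δ_p` of the sample covariance. -/
noncomputable def topEigenvalue {d n p : ℕ} (hp : p < d) (x : Fin n → Fin d → ℝ)
    (j : Fin p) : ℝ :=
  sampleEigenvalue x (Fin.castLE hp.le j)

/-- The columns of `U` are orthonormal eigenvectors of the sample covariance for its top `p`
eigenvalues: `Uᵀ U = I` and `S U = U Δ_p`. -/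
def IsTopEigenvectors {d n p : ℕ} (hp : p < d) (x : Fin n → Fin d → ℝ)
    (U : Matrix (Fin d) (Fin p) ℝ) : Prop :=
  Uᵀ * U = 1 ∧ sampleCovariance x * U = U * Matrix.diagonal (topEigenvalue hp x)

/-- The log-likelihood of the data in factor analysis with loading matrix `Λ`, noise covariance
`Ψ` and translation the data mean: the marginal law of each data point is
`N(μ, Λ Λᵀ + Ψ)`. -/
noncomputable def factorAnalysisLogLikelihood {d n p : ℕ} (x : Fin n → Fin d → ℝ)
    (Λ : Matrix (Fin d) (Fin p) ℝ) (Ψ : Matrix (Fin d) (Fin d) ℝ) : ℝ :=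
  ∑ i, Real.log (gaussianDensity (sampleMean x) (Λ * Λᵀ + Ψ) (x i))

/-- Probabilistic PCA is factor analysis with isotropic noise, `Ψ = σ² I`. -/
noncomputable def logLikelihood {d n p : ℕ} (x : Fin n → Fin d → ℝ)
    (Λ : Matrix (Fin d) (Fin p) ℝ) (σ : ℝ) : ℝ :=
  factorAnalysisLogLikelihood x Λ (σ ^ 2 • (1 : Matrix (Fin d) (Fin d) ℝ))

/-- `(Λ, σ)` is a maximum likelihood estimate: it maximizes the log-likelihood among all
`d × p` loading matrices and all positive noise levels. -/
def IsMLE {d n p : ℕ} (x : Fin n → Fin d → ℝ) (Λ : Matrix (Fin d) (Fin p) ℝ) (σ : ℝ) : Prop :=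
  0 < σ ∧ ∀ (Λ' : Matrix (Fin d) (Fin p) ℝ) (σ' : ℝ), 0 < σ' →
    logLikelihood x Λ' σ' ≤ logLikelihood x Λ σ

end PPCA

/-!
Up to the factor `-n/2` and an additive constant the log-likelihood is the discrepancy
`log det C + tr (C⁻¹ S)` of `C = Λ Λᵀ + σ² I` (`logLikelihood_eq`), so the task is to minimize it.

Let `c` be the eigenvalues of `C` in decreasing order; `c i = σ²` for `i ≥ p`, because `Λ Λᵀ` has
rank at most `p`. In eigenbases of `S` and `C` the trace is `∑ W i j * δ j / c i` with a doubly
stochastic `W`, the entrywise square of an orthogonal matrix. By Birkhoff's theorem and the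
rearrangement inequality it is at least `∑ δ i / c i` (`sum_mul_le_of_doublyStochastic`). As `c` is
constant from `p` on, the last `δ i` may be replaced there by their mean, which gives the fitted
eigenvalues `m`. Termwise `log c i + m i / c i ≥ log m i + 1`, with equality only for `c i = m i`.
Hence the discrepancy is at least `∑ log m i + d`, and equality forces `c = m`
(`sum_log_fitted_le`), in particular the stated value of `σ²`.

Equality must also give information on eigenvectors. Since `S` may have repeated eigenvalues, and
some of the first `p` may even equal the mean of the others, this is read off from a second lower
bound, whose terms all have to be tight: `W i j ≠ 0` with `i < p` implies `δ j = δ i`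
(`eigenvalue_eq_of_weight_ne_zero`). So the first `p` eigenvectors of `Λ Λᵀ` form a matrix `U` with
`S U = U Δ_p`, and `Λ Λᵀ = U (Δ_p - σ² I) Uᵀ`. Two factors of the same Gram matrix differ by an
orthogonal matrix (`exists_orthogonal_mul_eq`), which is `R`.

Conversely the discrepancy of a pair of the stated form follows from `Uᵀ U = I` and `S U = U Δ_p`, and
is the minimum (`gaussianDiscrepancy_eq_minimum`).
-/

open scoped Matrix

namespace PPCA

/-! ### Diagonalization, doubly stochastic weights and Gram factors -/

/-- The spectral theorem with the eigenvalues in decreasing order along `Fin d`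
(`Matrix.IsHermitian.eigenvalues` lists them in an unspecified order). -/
theorem exists_orthogonal_diagonalization {d : ℕ} {A : Matrix (Fin d) (Fin d) ℝ}
    (hA : A.IsHermitian) :
    ∃ Q : Matrix (Fin d) (Fin d) ℝ, Qᵀ * Q = 1 ∧
      A = Q * Matrix.diagonal
        (fun j : Fin d => hA.eigenvalues₀ (Fin.cast (Fintype.card_fin d).symm j)) * Qᵀ := by
  let e : Fin d ≃ Fin d := (finCongr (Fintype.card_fin d).symm).trans
    (Fintype.equivOfCardEq (Fintype.card_fin _))
  let V : Matrix (Fin d) (Fin d) ℝ := hA.eigenvectorUnitary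
  have hV : Vᵀ * V = 1 := by
    have := Matrix.mem_unitaryGroup_iff'.mp hA.eigenvectorUnitary.2
    simpa [Matrix.star_eq_conjTranspose, V] using this
  have hspec : A = V * Matrix.diagonal hA.eigenvalues * Vᵀ := by
    have := hA.spectral_theorem
    rw [Unitary.conjStarAlgAut_apply] at this
    simpa [Matrix.star_eq_conjTranspose, V, Function.comp_def] using this
  have hdiag : Matrix.diagonal
      (fun j : Fin d => hA.eigenvalues₀ (Fin.cast (Fintype.card_fin d).symm j)) =
      (Matrix.diagonal hA.eigenvalues).submatrix e e := by
    rw [Matrix.submatrix_diagonal_equiv]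
    congr 1
    ext j
    simp [Matrix.IsHermitian.eigenvalues, e]
  refine ⟨V.submatrix id e, ?_, ?_⟩
  · rw [Matrix.transpose_submatrix, ← Matrix.submatrix_mul _ _ _ _ _ Function.bijective_id, hV]
    simp
  · rw [hdiag, Matrix.submatrix_mul_equiv, Matrix.transpose_submatrix, Matrix.submatrix_mul_equiv,
      ← hspec]
    simp

/-- Von Neumann's trace inequality in coordinates: by Birkhoff's theorem the left side is an
average over permutations, and each permutation is handled by the rearrangement inequality. -/
theorem sum_mul_le_of_doublyStochastic {d : ℕ} {W : Matrix (Fin d) (Fin d) ℝ}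
    (hW : W ∈ doublyStochastic ℝ (Fin d)) {f g : Fin d → ℝ} (hf : Antitone f) (hg : Antitone g) :
    ∑ i, ∑ j, W i j * (f i * g j) ≤ ∑ i, f i * g i := by
  obtain ⟨w, hw0, hw1, rfl⟩ := exists_eq_sum_perm_of_mem_doublyStochastic hW
  have hperm (τ : Equiv.Perm (Fin d)) :
      ∑ i, ∑ j, τ.permMatrix ℝ i j * (f i * g j) ≤ ∑ i, f i * g i := by
    have : ∀ i, ∑ j, τ.permMatrix ℝ i j * (f i * g j) = f i * g (τ i) := by
      intro i
      simp [Equiv.Perm.permMatrix, PEquiv.toMatrix_apply]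
    simp_rw [this]
    exact (hf.monovary hg).sum_mul_comp_perm_le_sum_mul
  calc ∑ i, ∑ j, (∑ τ, w τ • τ.permMatrix ℝ) i j * (f i * g j)
      = ∑ τ, w τ * ∑ i, ∑ j, τ.permMatrix ℝ i j * (f i * g j) := by
        simp_rw [Matrix.sum_apply, Matrix.smul_apply, smul_eq_mul, Finset.sum_mul, Finset.mul_sum,
          mul_assoc]
        exact (Finset.sum_congr rfl fun i _ => Finset.sum_comm).trans Finset.sum_comm
    _ ≤ ∑ τ, w τ * ∑ i, f i * g i :=
        Finset.sum_le_sum fun τ _ => mul_le_mul_of_nonneg_left (hperm τ) (hw0 τ)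
    _ = ∑ i, f i * g i := by rw [← Finset.sum_mul, hw1, one_mul]

theorem sq_mem_doublyStochastic {d : ℕ} {O : Matrix (Fin d) (Fin d) ℝ} (hO : Oᵀ * O = 1) :
    Matrix.of (fun i j => O i j ^ 2) ∈ doublyStochastic ℝ (Fin d) := by
  have hO' : O * Oᵀ = 1 := mul_eq_one_comm.mp hO
  rw [mem_doublyStochastic_iff_sum]
  refine ⟨fun i j => sq_nonneg _, fun i => ?_, fun j => ?_⟩
  · simpa [Matrix.mul_apply, sq] using congrFun (congrFun hO' i) i
  · simpa [Matrix.mul_apply, sq] using congrFun (congrFun hO j) j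

/-- If `‖f y‖ = ‖g y‖` for all `y`, then `f y ↦ g y` is a well-defined isometry on the range of
`f`, and it extends to the whole space. -/
theorem exists_linearIsometry_comp_eq {E F : Type*} [AddCommGroup E] [Module ℝ E]
    [NormedAddCommGroup F] [InnerProductSpace ℝ F] [FiniteDimensional ℝ F]
    (f g : E →ₗ[ℝ] F) (h : ∀ y, ‖f y‖ = ‖g y‖) :
    ∃ T : F →ₗᵢ[ℝ] F, ∀ y, T (f y) = g y := by
  obtain ⟨s, hs⟩ := f.rangeRestrict.exists_rightInverse_of_surjective f.range_rangeRestrict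
  have hfs (z : LinearMap.range f) : f (s z) = z := congrArg Subtype.val (LinearMap.congr_fun hs z)
  let T₀ : LinearMap.range f →ₗᵢ[ℝ] F := ⟨g.comp s, fun z => by
    rw [LinearMap.comp_apply, ← h, hfs]; rfl⟩
  refine ⟨T₀.extend, fun y => ?_⟩
  have h1 : T₀.extend (f y) = g (s (f.rangeRestrict y)) :=
    T₀.extend_apply (f.rangeRestrict y)
  rw [h1, ← sub_eq_zero, ← map_sub, ← norm_eq_zero, ← h, map_sub, hfs]
  simp

/-- Two factors of the same Gram matrix differ by an orthogonal matrix. -/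
theorem exists_orthogonal_mul_eq {m k : ℕ} {A B : Matrix (Fin m) (Fin k) ℝ}
    (h : A * Aᵀ = B * Bᵀ) :
    ∃ R ∈ Matrix.orthogonalGroup (Fin k) ℝ, A = B * R := by
  have hnorm (M : Matrix (Fin m) (Fin k) ℝ) (y : EuclideanSpace ℝ (Fin m)) :
      ‖Matrix.toEuclideanLin Mᵀ y‖ ^ 2 = y.ofLp ⬝ᵥ ((M * Mᵀ) *ᵥ y.ofLp) := by
    rw [← Matrix.mulVec_mulVec, Matrix.dotProduct_mulVec, ← Matrix.mulVec_transpose,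
      EuclideanSpace.real_norm_sq_eq]
    simp [dotProduct, sq]
  obtain ⟨T, hT⟩ := exists_linearIsometry_comp_eq (Matrix.toEuclideanLin Bᵀ)
    (Matrix.toEuclideanLin Aᵀ) (fun y => by
      rw [← sq_eq_sq₀ (norm_nonneg _) (norm_nonneg _), hnorm, hnorm, h])
  let M : Matrix (Fin k) (Fin k) ℝ := Matrix.toEuclideanLin.symm T.toLinearMap
  have hM (z : EuclideanSpace ℝ (Fin k)) : (T z).ofLp = M *ᵥ z.ofLp := by
    have : T z = Matrix.toEuclideanLin M z := by simp [M]
    rw [this]; rfl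
  have hMo : Mᵀ * M = 1 := by
    ext i j
    have := T.inner_map_map (EuclideanSpace.single j (1 : ℝ)) (EuclideanSpace.single i (1 : ℝ))
    simp only [PiLp.inner_apply, hM] at this
    simpa [Matrix.mul_apply, Matrix.one_apply, Pi.single_apply, eq_comm] using this
  refine ⟨Mᵀ, ?_, ?_⟩
  · rw [Matrix.mem_orthogonalGroup_iff]
    simpa [Matrix.star_eq_conjTranspose] using hMo
  · apply Matrix.transpose_injective
    rw [Matrix.transpose_mul, Matrix.transpose_transpose]
    ext i j
    have h2 := congrArg WithLp.ofLp (hT (EuclideanSpace.single j (1 : ℝ)))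
    rw [hM] at h2
    have h3 := congrFun h2 i
    simpa [Matrix.mul_apply, Matrix.mulVec, dotProduct, Pi.single_apply] using h3.symm

/-! ### The fitted spectrum -/

/-- The mean of the eigenvalues `δ j` with `p ≤ j`, that is, of all but the first `p`. -/
noncomputable def tailMean {d : ℕ} (p : ℕ) (δ : Fin d → ℝ) : ℝ :=
  1 / ((d : ℝ) - (p : ℝ)) * ∑ j ∈ Finset.univ.filter (fun j : Fin d => p ≤ (j : ℕ)), δ j

/-- The eigenvalues of the optimal covariance: the first `p` eigenvalues are kept, and the others
are replaced by their mean. -/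
noncomputable def fittedEigenvalue {d : ℕ} (p : ℕ) (δ : Fin d → ℝ) (j : Fin d) : ℝ :=
  if (j : ℕ) < p then δ j else tailMean p δ

/-- `log det C + tr (C⁻¹ S)`: up to a factor and a constant, the negative log-likelihood of a
centred Gaussian with covariance `C` for data with sample covariance `S`. -/
noncomputable def gaussianDiscrepancy {d : ℕ} (S C : Matrix (Fin d) (Fin d) ℝ) : ℝ :=
  Real.log C.det + (C⁻¹ * S).trace

theorem card_filter_le_val {d p : ℕ} (hp : p ≤ d) :
    ((Finset.univ.filter (fun j : Fin d => p ≤ (j : ℕ))).card : ℝ) = (d : ℝ) - p := by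
  have h1 : (Finset.univ.filter (fun j : Fin d => (j : ℕ) < p)).card = p := by
    rw [Fin.card_filter_val_lt, min_eq_right hp]
  have h2 := Finset.card_filter_add_card_filter_not (s := (Finset.univ : Finset (Fin d)))
    (fun j : Fin d => (j : ℕ) < p)
  simp only [not_lt, h1, Finset.card_univ, Fintype.card_fin] at h2
  rw [eq_sub_iff_add_eq', ← Nat.cast_add, h2]

theorem sum_castLE_eq_sum_filter {d p : ℕ} (hp : p ≤ d) (f : Fin d → ℝ) :
    ∑ j : Fin p, f (Fin.castLE hp j) =
      ∑ j ∈ Finset.univ.filter (fun j : Fin d => (j : ℕ) < p), f j := by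
  rw [Finset.sum_filter]
  refine Fintype.sum_of_injective (Fin.castLE hp) (Fin.castLE_injective hp) _ _
    (fun j hj => if_neg fun h => hj ⟨⟨j, h⟩, rfl⟩) fun j => by simp

theorem sum_castLE_add_sum_filter {d p : ℕ} (hp : p ≤ d) (f : Fin d → ℝ) :
    ∑ j : Fin p, f (Fin.castLE hp j) +
      ∑ j ∈ Finset.univ.filter (fun j : Fin d => p ≤ (j : ℕ)), f j = ∑ j, f j := by
  rw [sum_castLE_eq_sum_filter]
  simpa only [not_lt] using Finset.sum_filter_add_sum_filter_not
    Finset.univ (fun j : Fin d => (j : ℕ) < p) f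

/-! ### Eigenvalue inequalities -/

section spectrum

variable {d p : ℕ} {δ : Fin d → ℝ}

theorem sum_filter_eq_mul_tailMean (hp : p < d) (δ : Fin d → ℝ) :
    ∑ j ∈ Finset.univ.filter (fun j : Fin d => p ≤ (j : ℕ)), δ j =
      ((d : ℝ) - p) * tailMean p δ := by
  have : (p : ℝ) < d := by exact_mod_cast hp
  rw [tailMean, ← mul_assoc, mul_one_div_cancel (by linarith), one_mul]

theorem tailMean_pos (hp : p < d) (h0 : ∀ j, 0 ≤ δ j) (hpos : 0 < δ ⟨p, hp⟩) :
    0 < tailMean p δ := by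
  have : (p : ℝ) < d := by exact_mod_cast hp
  refine mul_pos (by rw [one_div_pos]; linarith) (hpos.trans_le ?_)
  exact Finset.single_le_sum (f := δ) (fun j _ => h0 j) (by simp)

theorem tailMean_le (hp : p < d) (hδ : Antitone δ) : tailMean p δ ≤ δ ⟨p, hp⟩ := by
  have : (p : ℝ) < d := by exact_mod_cast hp
  have h : ∑ j ∈ Finset.univ.filter (fun j : Fin d => p ≤ (j : ℕ)), δ j ≤
      ((d : ℝ) - p) * δ ⟨p, hp⟩ := by
    rw [← card_filter_le_val hp.le, ← nsmul_eq_mul]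
    refine Finset.sum_le_card_nsmul _ _ _ fun j hj => hδ ?_
    simpa [Fin.le_def] using hj
  rw [sum_filter_eq_mul_tailMean hp] at h
  exact le_of_mul_le_mul_left h (by linarith)

theorem tailMean_le_of_lt (hp : p < d) (hδ : Antitone δ) {j : Fin d} (hj : (j : ℕ) < p) :
    tailMean p δ ≤ δ j :=
  (tailMean_le hp hδ).trans (hδ (Fin.le_def.mpr hj.le))

/-- If one of the first `p` eigenvalues equals the mean of the remaining ones, then these are all
equal, so their mean is the least eigenvalue. -/
theorem tailMean_le_of_eq (hp : p < d) (hδ : Antitone δ) {i : Fin d} (hi : (i : ℕ) < p)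
    (h : δ i = tailMean p δ) (j : Fin d) : tailMean p δ ≤ δ j := by
  by_cases hj : (j : ℕ) < p
  · exact tailMean_le_of_lt hp hδ hj
  by_contra hlt
  have : (p : ℝ) < d := by exact_mod_cast hp
  have hsum : ∑ j ∈ Finset.univ.filter (fun j : Fin d => p ≤ (j : ℕ)), δ j <
      ∑ j ∈ Finset.univ.filter (fun j : Fin d => p ≤ (j : ℕ)), tailMean p δ := by
    refine Finset.sum_lt_sum (fun k hk => h ▸ hδ ?_) ⟨j, by simpa using hj, not_le.mp hlt⟩
    have : p ≤ (k : ℕ) := by simpa using hk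
    exact Fin.le_def.mpr (by omega)
  rw [sum_filter_eq_mul_tailMean hp, Finset.sum_const, nsmul_eq_mul,
    card_filter_le_val hp.le] at hsum
  exact lt_irrefl _ hsum

theorem fittedEigenvalue_of_lt {j : Fin d} (hj : (j : ℕ) < p) : fittedEigenvalue p δ j = δ j :=
  if_pos hj

theorem fittedEigenvalue_of_le {j : Fin d} (hj : p ≤ (j : ℕ)) :
    fittedEigenvalue p δ j = tailMean p δ :=
  if_neg (not_lt.mpr hj)

theorem tailMean_le_fittedEigenvalue (hp : p < d) (hδ : Antitone δ) (j : Fin d) :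
    tailMean p δ ≤ fittedEigenvalue p δ j := by
  rw [fittedEigenvalue]
  split_ifs with hj
  exacts [tailMean_le_of_lt hp hδ hj, le_rfl]

theorem fittedEigenvalue_pos (hp : p < d) (hδ : Antitone δ) (h0 : ∀ j, 0 ≤ δ j)
    (hpos : 0 < δ ⟨p, hp⟩) (j : Fin d) : 0 < fittedEigenvalue p δ j :=
  (tailMean_pos hp h0 hpos).trans_le (tailMean_le_fittedEigenvalue hp hδ j)

/-- Against weights that are constant from index `p` on, averaging the last eigenvalues makes no
difference. -/
theorem sum_mul_fittedEigenvalue (hp : p < d) {a : Fin d → ℝ} {t : ℝ}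
    (ha : ∀ j : Fin d, p ≤ (j : ℕ) → a j = t) :
    ∑ j, a j * fittedEigenvalue p δ j = ∑ j, a j * δ j := by
  rw [← sum_castLE_add_sum_filter hp.le, ← sum_castLE_add_sum_filter hp.le]
  congr 1
  · exact Finset.sum_congr rfl fun j _ => by rw [fittedEigenvalue_of_lt (by simp)]
  · have h1 : ∀ j ∈ Finset.univ.filter (fun j : Fin d => p ≤ (j : ℕ)),
        a j * fittedEigenvalue p δ j = t * tailMean p δ := fun j hj => by
      have hj : p ≤ (j : ℕ) := by simpa using hj
      rw [ha j hj, fittedEigenvalue_of_le hj]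
    have h2 : ∀ j ∈ Finset.univ.filter (fun j : Fin d => p ≤ (j : ℕ)),
        a j * δ j = t * δ j := fun j hj => by rw [ha j (by simpa using hj)]
    rw [Finset.sum_congr rfl h1, Finset.sum_congr rfl h2, Finset.sum_const, nsmul_eq_mul,
      card_filter_le_val hp.le, ← Finset.mul_sum, sum_filter_eq_mul_tailMean hp]
    ring

theorem log_add_one_le_log_add_div {m c : ℝ} (hm : 0 < m) (hc : 0 < c) :
    Real.log m + 1 ≤ Real.log c + m / c := by
  have := Real.log_le_sub_one_of_pos (div_pos hm hc)
  rw [Real.log_div hm.ne' hc.ne'] at this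
  linarith

theorem log_add_one_lt_log_add_div {m c : ℝ} (hm : 0 < m) (hc : 0 < c) (h : c ≠ m) :
    Real.log m + 1 < Real.log c + m / c := by
  have := Real.log_lt_sub_one_of_pos (div_pos hm hc) (by
    rw [Ne, div_eq_one_iff_eq hc.ne']; exact h.symm)
  rw [Real.log_div hm.ne' hc.ne'] at this
  linarith

/-- On `[s, ∞)` the function `c ↦ log c + δ / c` has its unique minimum at `max δ s`. -/
theorem log_max_add_div_le {δ s c : ℝ} (hs : 0 < s) (hc : s ≤ c) :
    Real.log (max δ s) + δ / max δ s ≤ Real.log c + δ / c ∧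
      (Real.log c + δ / c = Real.log (max δ s) + δ / max δ s → c = max δ s) := by
  have hc0 : 0 < c := hs.trans_le hc
  have hm0 : 0 < max δ s := hs.trans_le (le_max_right _ _)
  -- if `δ < max δ s`, then `max δ s = s ≤ c`
  have hcomp : 0 ≤ (max δ s - δ) * (1 / max δ s - 1 / c) := by
    rcases le_total s δ with h | h
    · simp [max_eq_left h]
    · rw [max_eq_right h]
      exact mul_nonneg (by linarith) (by rw [sub_nonneg]; exact one_div_le_one_div_of_le hs hc)
  have hid : (max δ s - δ) * (1 / max δ s - 1 / c) =
      1 - δ / max δ s - max δ s / c + δ / c := by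
    field_simp
    ring
  refine ⟨?_, fun h => ?_⟩
  · have := log_add_one_le_log_add_div hm0 hc0
    linarith
  · by_contra hne
    have := log_add_one_lt_log_add_div hm0 hc0 hne
    linarith

/-- The gain from using the best value in `[s, ∞)` instead of `s` in `log c + δ / c` is larger for
larger `δ`. -/
theorem antitone_log_gap {s : ℝ} (hs : 0 < s) (hδ : Antitone δ) :
    Antitone fun j => Real.log s + δ j / s -
      (Real.log (max (δ j) s) + δ j / max (δ j) s) := by
  intro i j hij
  have h1 := (log_max_add_div_le (δ := δ i) hs (le_max_right (δ j) s)).1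
  have h2 : (δ i - δ j) / max (δ j) s ≤ (δ i - δ j) / s :=
    div_le_div_of_nonneg_left (sub_nonneg.mpr (hδ hij)) hs (le_max_right _ _)
  rw [sub_div, sub_div] at h2
  simp only
  linarith

/-- The sharp lower bound for the discrepancy in terms of eigenvalues `c` that are constant from
index `p` on; it determines `c` completely. -/
theorem sum_log_fitted_le {c : Fin d → ℝ} {t : ℝ} (hp : p < d) (hδ : Antitone δ)
    (h0 : ∀ j, 0 ≤ δ j) (hpos : 0 < δ ⟨p, hp⟩) {W : Matrix (Fin d) (Fin d) ℝ}
    (hW : W ∈ doublyStochastic ℝ (Fin d)) (hc0 : ∀ i, 0 < c i) (hc : Antitone c)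
    (hct : ∀ i : Fin d, p ≤ (i : ℕ) → c i = t) :
    ∑ i, Real.log (fittedEigenvalue p δ i) + d ≤
        ∑ i, Real.log (c i) + ∑ i, ∑ j, W i j * ((c i)⁻¹ * δ j) ∧
      (∑ i, Real.log (c i) + ∑ i, ∑ j, W i j * ((c i)⁻¹ * δ j) =
        ∑ i, Real.log (fittedEigenvalue p δ i) + d → c = fittedEigenvalue p δ) := by
  have hm := fittedEigenvalue_pos hp hδ h0 hpos
  -- the weights can be replaced by the identity, as `1 / c` increases while `δ` decreases
  have hneu : ∑ i, (c i)⁻¹ * fittedEigenvalue p δ i ≤ ∑ i, ∑ j, W i j * ((c i)⁻¹ * δ j) := by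
    rw [sum_mul_fittedEigenvalue hp (t := t⁻¹) fun j hj => by rw [hct j hj]]
    have hanti : Antitone fun i => -(c i)⁻¹ := fun i j hij =>
      neg_le_neg (inv_anti₀ (hc0 j) (hc hij))
    have := sum_mul_le_of_doublyStochastic hW hanti hδ
    simp only [neg_mul, mul_neg, Finset.sum_neg_distrib] at this
    linarith
  have hterm (i : Fin d) : Real.log (fittedEigenvalue p δ i) + 1 ≤
      Real.log (c i) + (c i)⁻¹ * fittedEigenvalue p δ i := by
    rw [inv_mul_eq_div]
    exact log_add_one_le_log_add_div (hm i) (hc0 i)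
  have hL : ∑ i, (Real.log (fittedEigenvalue p δ i) + 1) =
      ∑ i, Real.log (fittedEigenvalue p δ i) + d := by
    simp [Finset.sum_add_distrib]
  have hsum := Finset.sum_le_sum fun i (_ : i ∈ Finset.univ) => hterm i
  have hR : ∑ i, (Real.log (c i) + (c i)⁻¹ * fittedEigenvalue p δ i) =
      ∑ i, Real.log (c i) + ∑ i, (c i)⁻¹ * fittedEigenvalue p δ i := Finset.sum_add_distrib
  refine ⟨by linarith, fun h => ?_⟩
  by_contra hne
  obtain ⟨i, hi⟩ := Function.ne_iff.mp hne
  have hlt := Finset.sum_lt_sum (fun i (_ : i ∈ Finset.univ) => hterm i)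
    ⟨i, Finset.mem_univ i, by
      rw [inv_mul_eq_div]; exact log_add_one_lt_log_add_div (hm i) (hc0 i) hi⟩
  linarith

/-- If the weights `W` attain the minimum for the optimal eigenvalues, then a row `i < p` of `W` is
supported on the `j` with `δ j = δ i`. The sum is bounded below by letting each of the first `p`
rows use, at every `δ j`, the best variance in `[tailMean, ∞)`: the total gain is largest when these
rows cover the `p` largest `δ j`, and then the bound equals the minimum, so no term has slack. -/
theorem eigenvalue_eq_of_weight_ne_zero (hp : p < d) (hδ : Antitone δ)
    (h0 : ∀ j, 0 ≤ δ j) (hpos : 0 < δ ⟨p, hp⟩) {W : Matrix (Fin d) (Fin d) ℝ}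
    (hW : W ∈ doublyStochastic ℝ (Fin d))
    (h : ∑ i, ∑ j, W i j * ((fittedEigenvalue p δ i)⁻¹ * δ j) = d)
    {i j : Fin d} (hi : (i : ℕ) < p) (hij : W i j ≠ 0) : δ j = δ i := by
  set s := tailMean p δ with hs_def
  have hs : 0 < s := tailMean_pos hp h0 hpos
  have hsm := tailMean_le_fittedEigenvalue hp hδ
  set m := fittedEigenvalue p δ with hm_def
  -- `H j` is the least cost of `δ j` over variances `≥ s`, `E j` its cost at the variance `s`, and
  -- `f` marks the first `p` rows
  let H : Fin d → ℝ := fun j => Real.log (max (δ j) s) + δ j / max (δ j) s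
  let E : Fin d → ℝ := fun j => Real.log s + δ j / s
  let f : Fin d → ℝ := fun i => if (i : ℕ) < p then 1 else 0
  have hf : Antitone f := by
    intro a b hab
    have : (a : ℕ) ≤ b := hab
    simp only [f]
    split_ifs <;> first | omega | norm_num
  -- the slack of the entry `(i, j)` in the lower bound
  let k : Fin d → Fin d → ℝ := fun i j => Real.log (m i) + δ j / m i - (E j - f i * (E j - H j))
  have hk (i j : Fin d) : 0 ≤ k i j := by
    by_cases hi : (i : ℕ) < p
    · have := (log_max_add_div_le (δ := δ j) hs (hsm i)).1
      simp only [k, f, H, if_pos hi]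
      linarith
    · simp [k, f, E, if_neg hi, hm_def, fittedEigenvalue_of_le (not_lt.mp hi), hs_def]
  have hbath := sum_mul_le_of_doublyStochastic hW hf (antitone_log_gap hs hδ)
  -- the lower bound takes the minimal value when row `j` is matched with `δ j`
  have hdiag : ∑ j, (E j - f j * (E j - H j)) = ∑ j, Real.log (m j) + d := by
    have h1 : ∀ j, E j - f j * (E j - H j) = Real.log (m j) + (m j)⁻¹ * δ j := by
      intro j
      by_cases hj : (j : ℕ) < p
      · have : s ≤ δ j := tailMean_le_of_lt hp hδ hj
        simp [f, H, if_pos hj, hm_def, fittedEigenvalue_of_lt hj, max_eq_left this, inv_mul_eq_div]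
      · simp [f, E, if_neg hj, hm_def, fittedEigenvalue_of_le (not_lt.mp hj), hs_def,
          inv_mul_eq_div]
    simp_rw [h1]
    rw [Finset.sum_add_distrib, ← sum_mul_fittedEigenvalue hp (t := s⁻¹) fun j hj => by
      rw [hm_def, fittedEigenvalue_of_le hj]]
    congr 1
    have (j : Fin d) : (m j)⁻¹ * fittedEigenvalue p δ j = 1 :=
      inv_mul_cancel₀ (hs.trans_le (hsm j)).ne'
    simp [this]
  have hrow (i : Fin d) : ∑ j, W i j = 1 := sum_row_of_mem_doublyStochastic hW i
  have hcol (j : Fin d) : ∑ i, W i j = 1 := sum_col_of_mem_doublyStochastic hW j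
  have hsplit : ∑ i, ∑ j, W i j * k i j =
      (∑ i, Real.log (m i) + ∑ i, ∑ j, W i j * ((m i)⁻¹ * δ j)) -
        (∑ j, E j - ∑ i, ∑ j, W i j * (f i * (E j - H j))) := by
    have e1 : ∑ i, ∑ j, W i j * Real.log (m i) = ∑ i, Real.log (m i) :=
      Finset.sum_congr rfl fun i _ => by rw [← Finset.sum_mul, hrow, one_mul]
    have e2 : ∑ i, ∑ j, W i j * E j = ∑ j, E j := by
      rw [Finset.sum_comm]
      exact Finset.sum_congr rfl fun j _ => by rw [← Finset.sum_mul, hcol, one_mul]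
    rw [← e1, ← e2]
    simp only [← Finset.sum_add_distrib, ← Finset.sum_sub_distrib]
    refine Finset.sum_congr rfl fun i _ => Finset.sum_congr rfl fun j _ => ?_
    simp only [k]
    ring
  have hdiag' : ∑ j, E j - ∑ j, f j * (E j - H j) = ∑ j, Real.log (m j) + d := by
    rw [← hdiag, Finset.sum_sub_distrib]
  have hle : ∑ i, ∑ j, W i j * k i j ≤ 0 := by
    rw [hsplit, h]
    change ∑ i, ∑ j, W i j * (f i * (E j - H j)) ≤ ∑ j, f j * (E j - H j) at hbath
    linarith
  have hWk (i j : Fin d) : 0 ≤ W i j * k i j :=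
    mul_nonneg (nonneg_of_mem_doublyStochastic hW) (hk i j)
  have hz : W i j * k i j = 0 := by
    have h1 := (Finset.sum_eq_zero_iff_of_nonneg fun i _ =>
      Finset.sum_nonneg fun j _ => hWk i j).mp
      (le_antisymm hle (Finset.sum_nonneg fun i _ => Finset.sum_nonneg fun j _ => hWk i j))
      i (Finset.mem_univ i)
    exact (Finset.sum_eq_zero_iff_of_nonneg fun j _ => hWk i j).mp h1 j (Finset.mem_univ j)
  have hk0 : k i j = 0 := (mul_eq_zero.mp hz).resolve_left hij
  have hmax : m i = max (δ j) s := by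
    refine (log_max_add_div_le hs (hsm i)).2 ?_
    simp only [k, f, H, if_pos hi] at hk0
    linarith
  rw [hm_def, fittedEigenvalue_of_lt hi] at hmax
  -- `δ j < s` would force `δ i = s`, and then no eigenvalue lies below `s`
  rcases le_total s (δ j) with hj | hj
  · rw [hmax, max_eq_left hj]
  · rw [max_eq_right hj] at hmax
    rw [hmax]
    exact le_antisymm hj (tailMean_le_of_eq hp hδ hi hmax j)

end spectrum

/-! ### The log-likelihood as a matrix discrepancy -/

section matrices

variable {d p n : ℕ}

theorem posDef_mul_transpose_add_smul_one (Λ : Matrix (Fin d) (Fin p) ℝ) {σ : ℝ} (hσ : 0 < σ) :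
    (Λ * Λᵀ + σ ^ 2 • (1 : Matrix (Fin d) (Fin d) ℝ)).PosDef := by
  have h1 : (Λ * Λᵀ).PosSemidef := by
    simpa using Matrix.posSemidef_self_mul_conjTranspose Λ
  exact Matrix.PosDef.posSemidef_add h1 (Matrix.PosDef.one.smul (by positivity))

/-- The data enter the log-likelihood only through the sample covariance. -/
theorem sum_dotProduct_mulVec_eq_trace (x : Fin n → Fin d → ℝ) (M : Matrix (Fin d) (Fin d) ℝ) :
    ∑ i, (x i - sampleMean x) ⬝ᵥ (M *ᵥ (x i - sampleMean x)) =
      n * (M * sampleCovariance x).trace := by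
  have h (y : Fin d → ℝ) : y ⬝ᵥ (M *ᵥ y) = (M * Matrix.vecMulVec y y).trace := by
    rw [Matrix.mul_vecMulVec, Matrix.trace_vecMulVec, dotProduct_comm]
  rcases Nat.eq_zero_or_pos n with rfl | hn
  · simp
  have hn' : (n : ℝ) ≠ 0 := by positivity
  simp_rw [h]
  rw [sampleCovariance, Matrix.mul_smul, Matrix.trace_smul, Matrix.mul_sum, Matrix.trace_sum,
    smul_eq_mul, ← mul_assoc, mul_one_div_cancel hn', one_mul]

theorem log_gaussianDensity {μ y : Fin d → ℝ} {C : Matrix (Fin d) (Fin d) ℝ} (hC : 0 < C.det) :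
    Real.log (gaussianDensity μ C y) =
      -(1 / 2) * (d * Real.log (2 * Real.pi) + Real.log C.det +
        (y - μ) ⬝ᵥ (C⁻¹ *ᵥ (y - μ))) := by
  have hpi : 0 < (2 * Real.pi) ^ d := by positivity
  have hprod : 0 < (2 * Real.pi) ^ d * C.det := mul_pos hpi hC
  rw [gaussianDensity, Real.log_mul (one_div_pos.mpr (Real.sqrt_pos.mpr hprod)).ne'
    (Real.exp_pos _).ne', Real.log_exp, one_div, Real.log_inv, Real.log_sqrt hprod.le,
    Real.log_mul hpi.ne' hC.ne', Real.log_pow]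
  ring

theorem logLikelihood_eq (x : Fin n → Fin d → ℝ) (Λ : Matrix (Fin d) (Fin p) ℝ) {σ : ℝ}
    (hσ : 0 < σ) :
    logLikelihood x Λ σ = -(n / 2) * (d * Real.log (2 * Real.pi) +
      gaussianDiscrepancy (sampleCovariance x) (Λ * Λᵀ + σ ^ 2 • 1)) := by
  have hdet := (posDef_mul_transpose_add_smul_one Λ hσ).det_pos
  rw [logLikelihood, factorAnalysisLogLikelihood]
  simp_rw [log_gaussianDensity hdet]
  rw [← Finset.mul_sum, Finset.sum_add_distrib, sum_dotProduct_mulVec_eq_trace,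
    Finset.sum_const, gaussianDiscrepancy]
  simp only [Finset.card_univ, Fintype.card_fin, nsmul_eq_mul]
  ring

/-- In eigenbases `P` of `S` and `Q` of `C` the trace term is a bilinear expression in the
eigenvalues, weighted by the squared entries of the orthogonal matrix `Qᵀ P`. -/
theorem gaussianDiscrepancy_conj_diagonal {P Q : Matrix (Fin d) (Fin d) ℝ} (hQ : Qᵀ * Q = 1)
    {δ c : Fin d → ℝ} (hc : ∀ i, 0 < c i) :
    gaussianDiscrepancy (P * Matrix.diagonal δ * Pᵀ) (Q * Matrix.diagonal c * Qᵀ) =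
      ∑ i, Real.log (c i) + ∑ i, ∑ j, (Qᵀ * P) i j ^ 2 * ((c i)⁻¹ * δ j) := by
  have hQ' : Q * Qᵀ = 1 := mul_eq_one_comm.mp hQ
  have hinv : (Q * Matrix.diagonal c * Qᵀ)⁻¹ = Q * Matrix.diagonal (fun i => (c i)⁻¹) * Qᵀ := by
    refine Matrix.inv_eq_right_inv ?_
    calc Q * Matrix.diagonal c * Qᵀ * (Q * Matrix.diagonal (fun i => (c i)⁻¹) * Qᵀ)
        = Q * (Matrix.diagonal c * ((Qᵀ * Q) * Matrix.diagonal (fun i => (c i)⁻¹))) * Qᵀ := by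
          simp only [Matrix.mul_assoc]
      _ = 1 := by
          rw [hQ, Matrix.one_mul, Matrix.diagonal_mul_diagonal]
          simp [(hc _).ne', hQ']
  have hdet : (Q * Matrix.diagonal c * Qᵀ).det = ∏ i, c i := by
    rw [Matrix.det_mul_comm, ← Matrix.mul_assoc, hQ, Matrix.one_mul, Matrix.det_diagonal]
  rw [gaussianDiscrepancy, hdet, Real.log_prod fun i _ => (hc i).ne', hinv]
  congr 1
  set O := Qᵀ * P with hO
  have hO' : Pᵀ * Q = Oᵀ := by rw [hO, Matrix.transpose_mul, Matrix.transpose_transpose]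
  have : (Q * Matrix.diagonal (fun i => (c i)⁻¹) * Qᵀ * (P * Matrix.diagonal δ * Pᵀ)).trace =
      (Matrix.diagonal (fun i => (c i)⁻¹) * (O * (Matrix.diagonal δ * Oᵀ))).trace := by
    rw [← hO', hO, Matrix.mul_assoc, Matrix.mul_assoc, Matrix.trace_mul_comm]
    simp only [Matrix.mul_assoc]
  rw [this, Matrix.trace]
  refine Finset.sum_congr rfl fun i _ => ?_
  rw [Matrix.diag_apply, Matrix.diagonal_mul, Matrix.mul_apply, Finset.mul_sum]
  refine Finset.sum_congr rfl fun j _ => ?_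
  rw [Matrix.diagonal_mul, Matrix.transpose_apply]
  ring

/-- The discrepancy of `C = U (diag a - s) Uᵀ + s I` when the columns of `U` are orthonormal
eigenvectors of `S` with eigenvalues `a`. The determinant comes from Sylvester's identity
`det (1 + A B) = det (1 + B A)`, and the inverse is `s⁻¹ I - U (s⁻¹ - (diag a)⁻¹) Uᵀ`. -/
theorem gaussianDiscrepancy_of_eigenvectors {S : Matrix (Fin d) (Fin d) ℝ}
    {U : Matrix (Fin d) (Fin p) ℝ} {a : Fin p → ℝ} {s : ℝ} (hs : 0 < s) (ha : ∀ j, 0 < a j)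
    (hU : Uᵀ * U = 1) (hSU : S * U = U * Matrix.diagonal a) :
    gaussianDiscrepancy S (U * Matrix.diagonal (fun j => a j - s) * Uᵀ + s • 1) =
      ∑ j, Real.log (a j) + (d - p) * Real.log s + (p + (S.trace - ∑ j, a j) / s) := by
  have hdet : (U * Matrix.diagonal (fun j => a j - s) * Uᵀ + s • 1).det =
      s ^ d * ∏ j, (s⁻¹ * a j) := by
    have h1 : U * Matrix.diagonal (fun j => a j - s) * Uᵀ + s • (1 : Matrix (Fin d) (Fin d) ℝ) =
        s • (1 + U * (s⁻¹ • (Matrix.diagonal (fun j => a j - s) * Uᵀ))) := by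
      rw [smul_add, Matrix.mul_smul, smul_smul, mul_inv_cancel₀ hs.ne', one_smul,
        Matrix.mul_assoc, add_comm]
    have h2 : 1 + s⁻¹ • (Matrix.diagonal (fun j => a j - s) * Uᵀ) * U =
        Matrix.diagonal (fun j => s⁻¹ * a j) := by
      rw [Matrix.smul_mul, Matrix.mul_assoc, hU, Matrix.mul_one, ← Matrix.diagonal_one,
        ← Matrix.diagonal_smul, Matrix.diagonal_add]
      congr 1
      ext j
      simp only [Pi.smul_apply, smul_eq_mul]
      field_simp
      ring
    rw [h1, Matrix.det_smul, Matrix.det_one_add_mul_comm, h2, Matrix.det_diagonal,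
      Fintype.card_fin]
  have hinv : (U * Matrix.diagonal (fun j => a j - s) * Uᵀ + s • 1)⁻¹ =
      s⁻¹ • 1 - U * Matrix.diagonal (fun j => s⁻¹ - (a j)⁻¹) * Uᵀ := by
    refine Matrix.inv_eq_right_inv ?_
    set D := Matrix.diagonal (fun j => a j - s) with hD
    set G := Matrix.diagonal (fun j => s⁻¹ - (a j)⁻¹) with hG
    have hcore : s⁻¹ • D - D * G - s • G = 0 := by
      rw [hD, hG, Matrix.diagonal_mul_diagonal, ← Matrix.diagonal_smul, ← Matrix.diagonal_smul,
        Matrix.diagonal_sub, Matrix.diagonal_sub, ← Matrix.diagonal_zero]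
      congr 1
      ext j
      have := (ha j).ne'
      simp only [Pi.smul_apply, smul_eq_mul]
      field_simp
      ring
    have hUU : U * D * Uᵀ * (U * G * Uᵀ) = U * (D * G) * Uᵀ := by
      calc U * D * Uᵀ * (U * G * Uᵀ) = U * D * (Uᵀ * U) * G * Uᵀ := by
            simp only [Matrix.mul_assoc]
        _ = U * (D * G) * Uᵀ := by rw [hU, Matrix.mul_one, Matrix.mul_assoc U D G]
    calc (U * D * Uᵀ + s • 1) * (s⁻¹ • 1 - U * G * Uᵀ)
        = U * (s⁻¹ • D - D * G - s • G) * Uᵀ + (s * s⁻¹) • 1 := by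
          rw [Matrix.add_mul, Matrix.mul_sub, Matrix.mul_sub, hUU]
          simp only [Matrix.mul_sub, Matrix.sub_mul, Matrix.mul_smul, Matrix.smul_mul,
            Matrix.mul_one, Matrix.one_mul, smul_smul]
          rw [mul_comm s⁻¹ s]
          abel
      _ = 1 := by rw [hcore, mul_inv_cancel₀ hs.ne']; simp
  have htr : ((s⁻¹ • 1 - U * Matrix.diagonal (fun j => s⁻¹ - (a j)⁻¹) * Uᵀ) * S).trace =
      p + (S.trace - ∑ j, a j) / s := by
    have h1 : (U * Matrix.diagonal (fun j => s⁻¹ - (a j)⁻¹) * Uᵀ * S).trace =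
        ∑ j, (s⁻¹ - (a j)⁻¹) * a j := by
      rw [Matrix.mul_assoc, Matrix.mul_assoc, Matrix.trace_mul_comm, Matrix.mul_assoc,
        Matrix.mul_assoc, hSU, ← Matrix.mul_assoc Uᵀ, hU, Matrix.one_mul,
        Matrix.diagonal_mul_diagonal, Matrix.trace_diagonal]
    have h2 : ∑ j, (s⁻¹ - (a j)⁻¹) * a j = (∑ j, a j) / s - p := by
      simp_rw [sub_mul, inv_mul_cancel₀ (ha _).ne']
      rw [Finset.sum_sub_distrib, ← Finset.mul_sum, inv_mul_eq_div]
      simp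
    rw [Matrix.sub_mul, Matrix.trace_sub, h1, h2, Matrix.smul_mul, Matrix.one_mul,
      Matrix.trace_smul, smul_eq_mul, inv_mul_eq_div]
    ring
  have hlog : ∀ j, Real.log (s⁻¹ * a j) = Real.log (a j) - Real.log s := fun j => by
    rw [Real.log_mul (inv_ne_zero hs.ne') (ha j).ne', Real.log_inv]
    ring
  rw [gaussianDiscrepancy, hinv, htr, hdet, Real.log_mul (pow_pos hs d).ne'
    (Finset.prod_pos fun j _ => mul_pos (inv_pos.mpr hs) (ha j)).ne',
    Real.log_prod fun j _ => (mul_pos (inv_pos.mpr hs) (ha j)).ne', Real.log_pow]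
  simp_rw [hlog]
  rw [Finset.sum_sub_distrib]
  simp only [Finset.sum_const, Finset.card_univ, Fintype.card_fin, nsmul_eq_mul]
  ring

/-- The eigenvalues of `Λ Λᵀ`, listed in decreasing order, are nonnegative and vanish from index
`p` on, since `Λ` has only `p` columns. -/
theorem eigenvalues_mul_transpose {Λ : Matrix (Fin d) (Fin p) ℝ} {Q : Matrix (Fin d) (Fin d) ℝ}
    (hQ : Qᵀ * Q = 1) {l : Fin d → ℝ} (hl : Antitone l)
    (h : Λ * Λᵀ = Q * Matrix.diagonal l * Qᵀ) :
    (∀ j, 0 ≤ l j) ∧ ∀ j : Fin d, p ≤ (j : ℕ) → l j = 0 := by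
  have hB : (Qᵀ * Λ) * (Qᵀ * Λ)ᵀ = Matrix.diagonal l := by
    calc (Qᵀ * Λ) * (Qᵀ * Λ)ᵀ = Qᵀ * (Λ * Λᵀ) * Q := by
          rw [Matrix.transpose_mul, Matrix.transpose_transpose]
          simp only [Matrix.mul_assoc]
      _ = (Qᵀ * Q) * Matrix.diagonal l * (Qᵀ * Q) := by
          rw [h]
          simp only [Matrix.mul_assoc]
      _ = Matrix.diagonal l := by rw [hQ, Matrix.one_mul, Matrix.mul_one]
  have h0 (j : Fin d) : 0 ≤ l j := by
    have := congrFun (congrFun hB j) j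
    rw [Matrix.diagonal_apply_eq, Matrix.mul_apply] at this
    rw [← this]
    exact Finset.sum_nonneg fun k _ => mul_self_nonneg _
  refine ⟨h0, fun j hj => ?_⟩
  by_contra hne
  have hrank : (Matrix.diagonal l).rank ≤ p := by
    rw [← hB]
    exact (Matrix.rank_mul_le_left _ _).trans (Matrix.rank_le_width _)
  rw [Matrix.rank_diagonal, Fintype.card_subtype] at hrank
  have hsub : Finset.Iic j ⊆ Finset.univ.filter fun i => l i ≠ 0 := fun i hi => by
    have hlj : 0 < l j := (h0 j).lt_of_ne' hne
    simpa using (hlj.trans_le (hl (Finset.mem_Iic.mp hi))).ne'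
  have := (Finset.card_le_card hsub).trans hrank
  rw [Fin.card_Iic] at this
  omega

theorem mul_diagonal_mul_transpose_eq_castLE (hp : p ≤ d) (Q : Matrix (Fin d) (Fin d) ℝ)
    {l : Fin d → ℝ} (hl : ∀ j : Fin d, p ≤ (j : ℕ) → l j = 0) :
    Q * Matrix.diagonal l * Qᵀ = Q.submatrix id (Fin.castLE hp) *
      Matrix.diagonal (fun j => l (Fin.castLE hp j)) * (Q.submatrix id (Fin.castLE hp))ᵀ := by
  ext a b
  rw [Matrix.mul_apply, Matrix.mul_apply]
  simp only [Matrix.mul_diagonal, Matrix.transpose_apply, Matrix.submatrix_apply, id_eq]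
  rw [← sum_castLE_add_sum_filter hp]
  simp only [add_eq_left]
  exact Finset.sum_eq_zero fun j hj => by rw [hl j (by simpa using hj)]; ring

theorem transpose_mul_submatrix_castLE (hp : p ≤ d) {Q : Matrix (Fin d) (Fin d) ℝ}
    (hQ : Qᵀ * Q = 1) :
    (Q.submatrix id (Fin.castLE hp))ᵀ * Q.submatrix id (Fin.castLE hp) = 1 := by
  rw [Matrix.transpose_submatrix, ← Matrix.submatrix_mul _ _ _ _ _ Function.bijective_id, hQ,
    Matrix.submatrix_one _ (Fin.castLE_injective hp)]

/-- If the `i`-th column of `Q` (`i < p`) is orthogonal to all eigenvectors of `S = P diag(δ) Pᵀ`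
for eigenvalues other than `δ i`, then it is itself an eigenvector of `S` for `δ i`. -/
theorem mul_submatrix_castLE_of_eigenvectors (hp : p ≤ d) {δ : Fin d → ℝ}
    {P Q : Matrix (Fin d) (Fin d) ℝ} (hP : P * Pᵀ = 1)
    (h : ∀ i j : Fin d, (i : ℕ) < p → (Qᵀ * P) i j ≠ 0 → δ j = δ i) :
    (P * Matrix.diagonal δ * Pᵀ) * Q.submatrix id (Fin.castLE hp) =
      Q.submatrix id (Fin.castLE hp) * Matrix.diagonal (fun j => δ (Fin.castLE hp j)) := by
  set U := Q.submatrix id (Fin.castLE hp) with hU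
  have hcomm : Matrix.diagonal δ * (Pᵀ * U) =
      (Pᵀ * U) * Matrix.diagonal (fun j => δ (Fin.castLE hp j)) := by
    ext j i
    rw [Matrix.diagonal_mul, Matrix.mul_diagonal]
    have hent : (Pᵀ * U) j i = (Qᵀ * P) (Fin.castLE hp i) j := by
      simp [Matrix.mul_apply, hU, mul_comm]
    rw [hent]
    by_cases hz : (Qᵀ * P) (Fin.castLE hp i) j = 0
    · rw [hz, mul_zero, zero_mul]
    · rw [h _ j (by simp) hz, mul_comm]
  rw [Matrix.mul_assoc, Matrix.mul_assoc, hcomm, ← Matrix.mul_assoc, ← Matrix.mul_assoc, hP,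
    Matrix.one_mul]

theorem mul_diagonal_sqrt_mul_transpose {U : Matrix (Fin d) (Fin p) ℝ} {a : Fin p → ℝ}
    (ha : ∀ j, 0 ≤ a j) {R : Matrix (Fin p) (Fin p) ℝ} (hR : R ∈ Matrix.orthogonalGroup (Fin p) ℝ) :
    (U * Matrix.diagonal (fun j => Real.sqrt (a j)) * R) *
      (U * Matrix.diagonal (fun j => Real.sqrt (a j)) * R)ᵀ = U * Matrix.diagonal a * Uᵀ := by
  have hRR : R * Rᵀ = 1 := by
    have := (Matrix.mem_orthogonalGroup_iff _ _).mp hR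
    simpa [Matrix.star_eq_conjTranspose] using this
  have hD : Matrix.diagonal (fun j => Real.sqrt (a j)) * Matrix.diagonal (fun j => Real.sqrt (a j))
      = Matrix.diagonal a := by
    rw [Matrix.diagonal_mul_diagonal]
    simp_rw [Real.mul_self_sqrt (ha _)]
  rw [Matrix.transpose_mul, Matrix.transpose_mul, Matrix.diagonal_transpose]
  calc _ = U * Matrix.diagonal (fun j => Real.sqrt (a j)) * (R * Rᵀ) *
        (Matrix.diagonal (fun j => Real.sqrt (a j)) * Uᵀ) := by simp only [Matrix.mul_assoc]
    _ = U * (Matrix.diagonal (fun j => Real.sqrt (a j)) *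
        Matrix.diagonal (fun j => Real.sqrt (a j))) * Uᵀ := by
        rw [hRR, Matrix.mul_one]
        simp only [Matrix.mul_assoc]
    _ = _ := by rw [hD]

end matrices

/-! ### The minimum of the discrepancy and its minimizers -/

section optimum

variable {d p : ℕ} {δ : Fin d → ℝ} {S P : Matrix (Fin d) (Fin d) ℝ}

/-- The sharp lower bound for the discrepancy over covariances `Λ Λᵀ + σ² I`, and the form of the
pairs `(Λ, σ)` that attain it: for `U` one can take the first `p` eigenvectors of `Λ Λᵀ`. -/
theorem minimum_le_gaussianDiscrepancy (hp : p < d) (hδ : Antitone δ) (h0 : ∀ j, 0 ≤ δ j)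
    (hpos : 0 < δ ⟨p, hp⟩) (hP : Pᵀ * P = 1) (hS : S = P * Matrix.diagonal δ * Pᵀ)
    (Λ : Matrix (Fin d) (Fin p) ℝ) {σ : ℝ} (hσ : 0 < σ) :
    ∑ i, Real.log (fittedEigenvalue p δ i) + d ≤
        gaussianDiscrepancy S (Λ * Λᵀ + σ ^ 2 • 1) ∧
      (gaussianDiscrepancy S (Λ * Λᵀ + σ ^ 2 • 1) =
          ∑ i, Real.log (fittedEigenvalue p δ i) + d →
        σ ^ 2 = tailMean p δ ∧
        ∃ (U : Matrix (Fin d) (Fin p) ℝ) (R : Matrix (Fin p) (Fin p) ℝ),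
          (Uᵀ * U = 1 ∧ S * U = U * Matrix.diagonal (fun j => δ (Fin.castLE hp.le j))) ∧
          R ∈ Matrix.orthogonalGroup (Fin p) ℝ ∧
          Λ = U * Matrix.diagonal (fun j => Real.sqrt (δ (Fin.castLE hp.le j) - σ ^ 2)) * R) := by
  have hΛ : (Λ * Λᵀ).IsHermitian := by
    simpa using Matrix.isHermitian_mul_conjTranspose_self Λ
  obtain ⟨Q, hQ, hQl⟩ := exists_orthogonal_diagonalization hΛ
  set l : Fin d → ℝ := fun j => hΛ.eigenvalues₀ (Fin.cast (Fintype.card_fin d).symm j)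
  have hl : Antitone l := fun i j hij => hΛ.eigenvalues₀_antitone (Fin.le_def.mpr hij)
  obtain ⟨hl0, hlp⟩ := eigenvalues_mul_transpose hQ hl hQl
  let c : Fin d → ℝ := fun i => l i + σ ^ 2
  have hc0 (i : Fin d) : 0 < c i := add_pos_of_nonneg_of_pos (hl0 i) (by positivity)
  have hc : Antitone c := fun i j hij => add_le_add_left (hl hij) _
  have hct (i : Fin d) (hi : p ≤ (i : ℕ)) : c i = σ ^ 2 := by simp [c, hlp i hi]
  -- `Λ Λᵀ + σ² I` has the eigenvectors of `Λ Λᵀ`, with eigenvalues shifted by `σ²`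
  have hC : Λ * Λᵀ + σ ^ 2 • 1 = Q * Matrix.diagonal c * Qᵀ := by
    have : Matrix.diagonal c = Matrix.diagonal l + σ ^ 2 • 1 := by
      rw [← Matrix.diagonal_one, ← Matrix.diagonal_smul, Matrix.diagonal_add]
      simp [c]
    rw [this, Matrix.mul_add, Matrix.add_mul, hQl, Matrix.mul_smul, Matrix.smul_mul,
      Matrix.mul_one, mul_eq_one_comm.mp hQ]
  have hO : (Qᵀ * P)ᵀ * (Qᵀ * P) = 1 := by
    rw [Matrix.transpose_mul, Matrix.transpose_transpose, Matrix.mul_assoc, ← Matrix.mul_assoc Q,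
      mul_eq_one_comm.mp hQ, Matrix.one_mul, hP]
  have hW := sq_mem_doublyStochastic hO
  have hval : gaussianDiscrepancy S (Λ * Λᵀ + σ ^ 2 • 1) = _ :=
    (by rw [hC, hS] : _ = _).trans (gaussianDiscrepancy_conj_diagonal (P := P) (δ := δ) hQ hc0)
  obtain ⟨hle, heq⟩ := sum_log_fitted_le hp hδ h0 hpos hW hc0 hc hct
  simp only [Matrix.of_apply] at hle heq
  rw [hval]
  refine ⟨hle, fun h => ?_⟩
  have hcm := heq h
  have hσs : σ ^ 2 = tailMean p δ := by
    rw [← hct ⟨p, hp⟩ le_rfl, hcm]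
    exact fittedEigenvalue_of_le (le_refl p)
  have hlδ (j : Fin p) : l (Fin.castLE hp.le j) = δ (Fin.castLE hp.le j) - σ ^ 2 := by
    rw [eq_sub_iff_add_eq]
    exact (congrFun hcm _).trans (fittedEigenvalue_of_lt (by simp))
  rw [hcm] at h
  have hweight (i j : Fin d) (hi : (i : ℕ) < p) (hij : (Qᵀ * P) i j ≠ 0) : δ j = δ i :=
    eigenvalue_eq_of_weight_ne_zero hp hδ h0 hpos hW (add_left_cancel h) hi (pow_ne_zero 2 hij)
  set U := Q.submatrix id (Fin.castLE hp.le) with hU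
  have hfact : Λ * Λᵀ = (U * Matrix.diagonal (fun j =>
        Real.sqrt (δ (Fin.castLE hp.le j) - σ ^ 2)) * (1 : Matrix (Fin p) (Fin p) ℝ)) *
      (U * Matrix.diagonal (fun j => Real.sqrt (δ (Fin.castLE hp.le j) - σ ^ 2)) *
        (1 : Matrix (Fin p) (Fin p) ℝ))ᵀ := by
    rw [mul_diagonal_sqrt_mul_transpose (fun j => hlδ j ▸ hl0 _) (one_mem _), hQl,
      mul_diagonal_mul_transpose_eq_castLE hp.le Q hlp]
    simp only [hlδ, hU]
  rw [Matrix.mul_one] at hfact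
  obtain ⟨R, hR, hΛR⟩ := exists_orthogonal_mul_eq hfact
  refine ⟨hσs, U, R, ⟨transpose_mul_submatrix_castLE hp.le hQ, ?_⟩, hR, hΛR⟩
  rw [hS]
  exact mul_submatrix_castLE_of_eigenvectors hp.le (mul_eq_one_comm.mp hP) hweight

/-- Every pair of the principal-component form attains the lower bound. -/
theorem gaussianDiscrepancy_eq_minimum (hp : p < d) (hδ : Antitone δ) (h0 : ∀ j, 0 ≤ δ j)
    (hpos : 0 < δ ⟨p, hp⟩) (htr : S.trace = ∑ j, δ j)
    {U : Matrix (Fin d) (Fin p) ℝ} (hU : Uᵀ * U = 1)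
    (hSU : S * U = U * Matrix.diagonal (fun j => δ (Fin.castLE hp.le j)))
    {R : Matrix (Fin p) (Fin p) ℝ} (hR : R ∈ Matrix.orthogonalGroup (Fin p) ℝ)
    {Λ : Matrix (Fin d) (Fin p) ℝ} {σ : ℝ} (hσ : σ ^ 2 = tailMean p δ)
    (hΛ : Λ = U * Matrix.diagonal (fun j => Real.sqrt (δ (Fin.castLE hp.le j) - σ ^ 2)) * R) :
    gaussianDiscrepancy S (Λ * Λᵀ + σ ^ 2 • 1) =
      ∑ i, Real.log (fittedEigenvalue p δ i) + d := by
  have hs := tailMean_pos hp h0 hpos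
  have hle (j : Fin p) : tailMean p δ ≤ δ (Fin.castLE hp.le j) :=
    tailMean_le_of_lt hp hδ (by simp)
  rw [hΛ, hσ, mul_diagonal_sqrt_mul_transpose (fun j => sub_nonneg.mpr (hle j)) hR,
    gaussianDiscrepancy_of_eigenvectors hs (fun j => hs.trans_le (hle j)) hU hSU, htr,
    ← sum_castLE_add_sum_filter hp.le δ, add_sub_cancel_left, sum_filter_eq_mul_tailMean hp,
    mul_div_cancel_right₀ _ hs.ne', ← sum_castLE_add_sum_filter hp.le]
  have h1 : ∑ j ∈ Finset.univ.filter (fun j : Fin d => p ≤ (j : ℕ)),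
      Real.log (fittedEigenvalue p δ j) = ((d : ℝ) - p) * Real.log (tailMean p δ) := by
    rw [← card_filter_le_val hp.le, ← nsmul_eq_mul, ← Finset.sum_const]
    exact Finset.sum_congr rfl fun j hj => by rw [fittedEigenvalue_of_le (by simpa using hj)]
  have h2 (j : Fin p) : fittedEigenvalue p δ (Fin.castLE hp.le j) = δ (Fin.castLE hp.le j) :=
    fittedEigenvalue_of_lt (by simp)
  simp_rw [h1, h2]
  ring

end optimum

/-! ### The sample covariance -/

theorem sampleCovariance_posSemidef {d n : ℕ} (x : Fin n → Fin d → ℝ) :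
    (sampleCovariance x).PosSemidef := by
  rw [sampleCovariance]
  refine (Matrix.posSemidef_sum _ fun i _ => ?_).smul (by positivity)
  simpa using Matrix.posSemidef_vecMulVec_self_star (x i - sampleMean x)

theorem sampleEigenvalue_antitone {d n : ℕ} (x : Fin n → Fin d → ℝ) :
    Antitone (sampleEigenvalue x) := fun _ _ hij =>
  (sampleCovariance_isHermitian x).eigenvalues₀_antitone (Fin.le_def.mpr hij)

end PPCA

theorem mainTheorem4 {d n p : ℕ} (hp : p < d) (x : Fin n → Fin d → ℝ)
    (hpos : 0 < PPCA.sampleEigenvalue x ⟨p, hp⟩) :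
    (∃ (Λ : Matrix (Fin d) (Fin p) ℝ) (σ : ℝ), PPCA.IsMLE x Λ σ) ∧
    ∀ (Λ : Matrix (Fin d) (Fin p) ℝ) (σ : ℝ), 0 < σ →
      (PPCA.IsMLE x Λ σ ↔
        σ ^ 2 = 1 / ((d : ℝ) - (p : ℝ)) *
            ∑ j ∈ Finset.univ.filter (fun j : Fin d => p ≤ (j : ℕ)), PPCA.sampleEigenvalue x j ∧
        ∃ (U : Matrix (Fin d) (Fin p) ℝ) (R : Matrix (Fin p) (Fin p) ℝ),
          PPCA.IsTopEigenvectors hp x U ∧ R ∈ Matrix.orthogonalGroup (Fin p) ℝ ∧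
          Λ = U * Matrix.diagonal
            (fun j : Fin p => Real.sqrt (PPCA.topEigenvalue hp x j - σ ^ 2)) * R) := by
  open PPCA in
  obtain ⟨P, hP, hS⟩ := exists_orthogonal_diagonalization (sampleCovariance_isHermitian x)
  change sampleCovariance x = P * Matrix.diagonal (sampleEigenvalue x) * Pᵀ at hS
  set δ := sampleEigenvalue x
  have hδ : Antitone δ := sampleEigenvalue_antitone x
  have hP' : P * Pᵀ = 1 := mul_eq_one_comm.mp hP
  have h0 (j : Fin d) : 0 ≤ δ j := by
    have h1 : Pᵀ * sampleCovariance x * P = Matrix.diagonal δ := by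
      calc Pᵀ * sampleCovariance x * P = (Pᵀ * P) * Matrix.diagonal δ * (Pᵀ * P) := by
            rw [hS]; simp only [Matrix.mul_assoc]
        _ = Matrix.diagonal δ := by rw [hP, Matrix.one_mul, Matrix.mul_one]
    have h2 : (Matrix.diagonal δ).PosSemidef := by
      rw [← h1]
      simpa using (sampleCovariance_posSemidef x).conjTranspose_mul_mul_same P
    exact Matrix.posSemidef_diagonal_iff.mp h2 j
  have htr : (sampleCovariance x).trace = ∑ j, δ j := by
    rw [hS, Matrix.mul_assoc, Matrix.trace_mul_comm, Matrix.mul_assoc, hP, Matrix.mul_one,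
      Matrix.trace_diagonal]
  -- without data the sample covariance is zero, against `hpos`
  have hn : (0 : ℝ) < n := by
    rcases Nat.eq_zero_or_pos n with rfl | hn
    · have hz : ∑ j, δ j = 0 := by rw [← htr, sampleCovariance]; simp
      have := (Finset.sum_eq_zero_iff_of_nonneg fun j _ => h0 j).mp hz ⟨p, hp⟩ (Finset.mem_univ _)
      exact absurd this hpos.ne'
    · exact_mod_cast hn
  have hs := tailMean_pos hp h0 hpos
  have hmono {Λ Λ' : Matrix (Fin d) (Fin p) ℝ} {σ σ' : ℝ} (hσ : 0 < σ) (hσ' : 0 < σ') :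
      logLikelihood x Λ' σ' ≤ logLikelihood x Λ σ ↔
        gaussianDiscrepancy (sampleCovariance x) (Λ * Λᵀ + σ ^ 2 • 1) ≤
          gaussianDiscrepancy (sampleCovariance x) (Λ' * Λ'ᵀ + σ' ^ 2 • 1) := by
    rw [logLikelihood_eq x Λ hσ, logLikelihood_eq x Λ' hσ', neg_mul, neg_mul, neg_le_neg_iff,
      mul_le_mul_iff_right₀ (by positivity), add_le_add_iff_left]
  have hbound := fun (Λ : Matrix (Fin d) (Fin p) ℝ) (σ : ℝ) (hσ : 0 < σ) =>
    minimum_le_gaussianDiscrepancy hp hδ h0 hpos hP hS Λ hσ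
  have hmle {Λ : Matrix (Fin d) (Fin p) ℝ} {σ : ℝ} (hσ : 0 < σ)
      (h : gaussianDiscrepancy (sampleCovariance x) (Λ * Λᵀ + σ ^ 2 • 1) =
        ∑ i, Real.log (fittedEigenvalue p δ i) + d) : IsMLE x Λ σ :=
    ⟨hσ, fun Λ' σ' hσ' => (hmono hσ hσ').mpr (h ▸ (hbound Λ' σ' hσ').1)⟩
  obtain ⟨Λ₀, σ₀, hσ₀, hopt⟩ : ∃ (Λ₀ : Matrix (Fin d) (Fin p) ℝ) (σ₀ : ℝ), 0 < σ₀ ∧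
      gaussianDiscrepancy (sampleCovariance x) (Λ₀ * Λ₀ᵀ + σ₀ ^ 2 • 1) =
        ∑ i, Real.log (fittedEigenvalue p δ i) + d := by
    refine ⟨_, Real.sqrt (tailMean p δ), Real.sqrt_pos.mpr hs,
      gaussianDiscrepancy_eq_minimum hp hδ h0 hpos htr
        (transpose_mul_submatrix_castLE hp.le hP) ?_ (one_mem _) (Real.sq_sqrt hs.le) rfl⟩
    rw [hS]
    refine mul_submatrix_castLE_of_eigenvectors hp.le hP' fun i j _ hij => ?_
    rw [hP, Matrix.one_apply] at hij
    rw [ite_ne_right_iff.mp hij |>.1]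
  refine ⟨⟨Λ₀, σ₀, hmle hσ₀ hopt⟩, fun Λ σ hσ => ⟨fun h => ?_, ?_⟩⟩
  · refine (hbound Λ σ hσ).2 (le_antisymm ?_ (hbound Λ σ hσ).1)
    exact hopt ▸ (hmono hσ hσ₀).mp (h.2 Λ₀ σ₀ hσ₀)
  · rintro ⟨hσs, U, R, ⟨hU, hSU⟩, hR, hΛ⟩
    exact hmle hσ (gaussianDiscrepancy_eq_minimum hp hδ h0 hpos htr hU hSU hR hσs hΛ)
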